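/- Let $SL_2=SL_2(\mathbb{C})$ act on $\mathbb{C}^2$ in the standard way, and let $V_1$ be the space of linear binary forms (linear forms on $\mathbb{C}^2$) with the natural action $(g\cdot f)(v)=f(g^{-1}v)$. Let $nV_1=V_1\oplus\cdots\oplus V_1$ ($n$ summands) with the diagonal action, and for a representation $W$ of $SL_2$ let $\mathbb{C}[W]^{SL_2}$ be the algebra of polynomial functions on $W$ that are constant on $SL_2$-orbits. Put $\mathcal{I}_n=\mathbb{C}[nV_1]^{SL_2}$ (the algebra of joint invariants of $n$ linear binary forms) and $\mathcal{C}_n=\mathbb{C}[nV_1\oplus\mathbb{C}^2]^{SL_2}$ (the algebra of joint covariants). Then (i) $\operatorname{tr\,deg}_{\mathbb{C}}\mathcal{I}_n=2n-3$ for all $n\ge 2$; (ii) $\operatorname{tr\,deg}_{\mathbb{C}}\mathcal{C}_n=2n-1$ for all $n\ge 1$. -/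

import Mathlib

noncomputable section

/-- The algebra `ℂ[W]` of polynomial functions on a complex vector space `W`: the algebra of
functions on `W` generated by the linear functionals. -/
def polyFun (W : Type*) [AddCommGroup W] [Module ℂ W] : Subalgebra ℂ (W → ℂ) :=
  Algebra.adjoin ℂ (Set.range fun φ : Module.Dual ℂ W => (φ : W → ℂ))

/-- The algebra `ℂ[W]^G` of invariant polynomial functions on a representation `W` of `G`. -/
def invariantAlgebra {G W : Type*} [Group G] [AddCommGroup W] [Module ℂ W]
    (ρ : Representation ℂ G W) : Subalgebra ℂ (W → ℂ) where
  carrier := {p | p ∈ polyFun W ∧ ∀ (g : G) (w : W), p (ρ g w) = p w}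
  mul_mem' := fun {p q} hp hq =>
    ⟨mul_mem hp.1 hq.1, fun g w => by simp only [Pi.mul_apply, hp.2 g w, hq.2 g w]⟩
  add_mem' := fun {p q} hp hq =>
    ⟨add_mem hp.1 hq.1, fun g w => by simp only [Pi.add_apply, hp.2 g w, hq.2 g w]⟩
  algebraMap_mem' := fun c => ⟨(polyFun W).algebraMap_mem c, fun _ _ => rfl⟩

/-- The complex special linear group `SL₂`. -/
abbrev SL2 : Type := Matrix.SpecialLinearGroup (Fin 2) ℂ

/-- The standard representation of `SL₂` on `ℂ²`, `g` acting by `v ↦ g v`. -/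
def stdRep : Representation ℂ SL2 (Fin 2 → ℂ) where
  toFun g := Matrix.toLin' (g : Matrix (Fin 2) (Fin 2) ℂ)
  map_one' := by simp; rfl
  map_mul' g h := by
    rw [Matrix.SpecialLinearGroup.coe_mul, Matrix.toLin'_mul]
    rfl

/-- The space `V₁` of linear binary forms, that is, of linear forms on `ℂ²`. -/
abbrev LinForm : Type := Module.Dual ℂ (Fin 2 → ℂ)

/-- The natural action of `SL₂` on linear binary forms, `(g f)(v) = f (g⁻¹ v)`. -/
def formRep : Representation ℂ SL2 LinForm := stdRep.dual

/-- The diagonal action of `SL₂` on `n V₁ = V₁ ⊕ ⋯ ⊕ V₁` (`n` summands). -/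
def formsRep (n : ℕ) : Representation ℂ SL2 (Fin n → LinForm) where
  toFun g := (formRep g).compLeft (Fin n)
  map_one' := by ext; simp
  map_mul' g h := by ext; simp

/-- The algebra `I_n = ℂ[n V₁]^{SL₂}` of joint invariants of `n` linear binary forms. -/
def jointInvariants (n : ℕ) : Subalgebra ℂ ((Fin n → LinForm) → ℂ) :=
  invariantAlgebra (formsRep n)

/-- The algebra `C_n = ℂ[n V₁ ⊕ ℂ²]^{SL₂}` of joint covariants of `n` linear binary forms. -/
def jointCovariants (n : ℕ) : Subalgebra ℂ ((Fin n → LinForm) × (Fin 2 → ℂ) → ℂ) :=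
  invariantAlgebra ((formsRep n).prod stdRep)

end

/-!
The area form identifies `V₁` with `ℂ²` as representations of `SL₂`, so both algebras consist of
invariants of tuples `v₀, …, vₖ₊₁` of vectors of `ℂ²` (for covariants the extra vector serves as
`v₀`). Where the bracket `t = [v₀, v₁]` is nonzero, every orbit contains exactly one tuple of the
form `(1, 0), (0, t), (xⱼ / t, yⱼ)`, and its parameters are the `2k + 1` brackets `t`,
`xⱼ = [vⱼ, v₁]`, `yⱼ = [v₀, vⱼ]`. Restricting invariants to these tuples shows that the brackets are
algebraically independent, and that every invariant becomes a polynomial in them after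
multiplication by a power of `t`.
-/

section RationalSection

open MvPolynomial

variable {R σ X : Type*} [CommRing R]

/-- The algebra `R[σ][1/d]` of regular functions on the principal open set `d ≠ 0` of affine space.
Its elements are encoded as total functions, whose values at the zeros of `d` are arbitrary. -/
def regularAway (d : MvPolynomial σ R) : Subalgebra R ((σ → R) → R) where
  carrier := {f | ∃ (N : ℕ) (Q : MvPolynomial σ R),
    ∀ c, eval c d ≠ 0 → eval c d ^ N * f c = eval c Q}
  algebraMap_mem' r := ⟨0, C r, fun c _ => by simp⟩
  add_mem' := by
    rintro f g ⟨N, P, hP⟩ ⟨M, Q, hQ⟩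
    refine ⟨N + M, d ^ M * P + d ^ N * Q, fun c hc => ?_⟩
    simp only [Pi.add_apply, map_add, map_mul, map_pow, ← hP c hc, ← hQ c hc]
    ring
  mul_mem' := by
    rintro f g ⟨N, P, hP⟩ ⟨M, Q, hQ⟩
    refine ⟨N + M, P * Q, fun c hc => ?_⟩
    simp only [Pi.mul_apply, map_mul, ← hP c hc, ← hQ c hc]
    ring

theorem eval_mem_regularAway (d P : MvPolynomial σ R) : (fun c => eval c P) ∈ regularAway d :=
  ⟨0, P, fun c _ => by simp⟩

theorem inv_eval_mem_regularAway {K : Type*} [Field K] (d : MvPolynomial σ K) :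
    (fun c => (eval c d)⁻¹) ∈ regularAway d :=
  ⟨1, 1, fun c hc => by simp [hc]⟩

variable {A : Subalgebra R (X → R)} {x : σ → A} {d : MvPolynomial σ R} {s : (σ → R) → X}

theorem coe_aeval_apply_eq_eval (x : σ → A) (P : MvPolynomial σ R) (w : X) :
    (aeval x P : X → R) w = eval (fun i => (x i : X → R) w) P :=
  comp_aeval_apply x ((Pi.evalAlgHom R (fun _ : X => R) w).comp A.val) P

theorem algebraicIndependent_of_section [IsDomain R] [Infinite R] (hd : d ≠ 0)
    (hxs : ∀ c, eval c d ≠ 0 → ∀ i, (x i : X → R) (s c) = c i) : AlgebraicIndependent R x := by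
  rw [algebraicIndependent_iff]
  intro P hP
  have hdP : d * P = 0 := MvPolynomial.funext fun c => by
    by_cases hc : eval c d = 0
    · simp [hc]
    · have h := coe_aeval_apply_eq_eval x P (s c)
      simp only [hP, hxs c hc] at h
      simp [← h]
  exact (mul_eq_zero.mp hdP).resolve_left hd

theorem exists_aeval_pow_mul_eq_aeval {p : A} (hp : (p : X → R) ∘ s ∈ regularAway d)
    (hsx : ∀ w, eval (fun i => (x i : X → R) w) d ≠ 0 →
      (p : X → R) (s fun i => (x i : X → R) w) = (p : X → R) w) :
    ∃ (N : ℕ) (Q : MvPolynomial σ R), aeval x d ^ N * p = aeval x Q := by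
  obtain ⟨N, Q, hQ⟩ := hp
  -- The additional factor `d` makes both sides vanish where the section is not defined.
  refine ⟨N + 1, d * Q, Subtype.ext (funext fun w => ?_)⟩
  change (aeval x d : X → R) w ^ (N + 1) * (p : X → R) w = (aeval x (d * Q) : X → R) w
  rw [coe_aeval_apply_eq_eval, coe_aeval_apply_eq_eval, map_mul]
  by_cases hw : eval (fun i => (x i : X → R) w) d = 0
  · simp [hw]
  · rw [← hsx w hw, ← hQ _ hw, Function.comp_apply]
    ring

theorem isTranscendenceBasis_of_section [IsDomain R] [Infinite R] [NoZeroDivisors A]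
    (hd : d ≠ 0)
    (hxs : ∀ c, eval c d ≠ 0 → ∀ i, (x i : X → R) (s c) = c i)
    (hreg : ∀ p ∈ A, p ∘ s ∈ regularAway d)
    (hsx : ∀ p ∈ A, ∀ w, eval (fun i => (x i : X → R) w) d ≠ 0 →
      p (s fun i => (x i : X → R) w) = p w) :
    IsTranscendenceBasis R x := by
  have hx : AlgebraicIndependent R x := algebraicIndependent_of_section hd hxs
  refine hx.isTranscendenceBasis_iff_isAlgebraic.mpr ⟨fun p => ?_⟩
  obtain ⟨N, Q, hpQ⟩ := exists_aeval_pow_mul_eq_aeval (x := x) (hreg p p.2) (hsx p p.2)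
  have hxd : aeval x d ≠ 0 := (map_ne_zero_iff _ hx).mpr hd
  have : Nontrivial A := ⟨_, _, hxd⟩
  have halg (P : MvPolynomial σ R) :
      IsAlgebraic (Algebra.adjoin R (Set.range x)) (aeval x P : A) := by
    have hP : aeval x P ∈ Algebra.adjoin R (Set.range x) := by
      rw [Algebra.adjoin_range_eq_range_aeval]
      exact ⟨P, rfl⟩
    exact isAlgebraic_algebraMap (⟨_, hP⟩ : Algebra.adjoin R (Set.range x))
  refine .of_mul (mem_nonZeroDivisors_of_ne_zero (pow_ne_zero N hxd)) ?_ (hpQ ▸ halg Q)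
  rw [← map_pow]
  exact halg (d ^ N)

end RationalSection

section PolynomialFunctions

variable {W X : Type*} [AddCommGroup W] [Module ℂ W]

theorem dual_mem_polyFun (φ : Module.Dual ℂ W) : ⇑φ ∈ polyFun W :=
  Algebra.subset_adjoin ⟨φ, rfl⟩

theorem comp_mem_of_mem_polyFun {A : Subalgebra ℂ (X → ℂ)} {s : X → W}
    (hs : ∀ φ : Module.Dual ℂ W, φ ∘ s ∈ A) {p : W → ℂ} (hp : p ∈ polyFun W) : p ∘ s ∈ A := by
  induction hp using Algebra.adjoin_induction with
  | mem p hp =>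
    obtain ⟨φ, rfl⟩ := hp
    exact hs φ
  | algebraMap r => exact A.algebraMap_mem r
  | add p q _ _ hp hq => exact add_mem hp hq
  | mul p q _ _ hp hq => exact mul_mem hp hq

theorem comp_mem_of_mem_polyFun_of_basis {ι : Type*} [Finite ι] (b : Module.Basis ι ℂ W)
    {A : Subalgebra ℂ (X → ℂ)} {s : X → W} (hs : ∀ i, b.coord i ∘ s ∈ A) {p : W → ℂ}
    (hp : p ∈ polyFun W) : p ∘ s ∈ A := by
  have := Fintype.ofFinite ι
  refine comp_mem_of_mem_polyFun (fun φ => ?_) hp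
  have hφ : φ ∘ s = ∑ i, φ (b i) • (b.coord i ∘ s) := by
    ext c
    conv_lhs => rw [← b.sum_dual_apply_smul_coord φ]
    simp only [Function.comp_apply, LinearMap.sum_apply, LinearMap.smul_apply, Finset.sum_apply,
      Pi.smul_apply]
  exact hφ ▸ sum_mem fun i _ => A.smul_mem (hs i) _

theorem exists_polynomial_of_mem_polyFun {p : W → ℂ} (hp : p ∈ polyFun W) (a b : W) :
    ∃ P : Polynomial ℂ, ∀ t : ℂ, p (a + t • b) = P.eval t := by
  have hline : (fun t : ℂ => p (a + t • b)) ∈ (Polynomial.aeval (R := ℂ) (id : ℂ → ℂ)).range := by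
    refine comp_mem_of_mem_polyFun (s := fun t : ℂ => a + t • b) (fun φ => ?_) hp
    refine ⟨.C (φ a) + .X * .C (φ b), funext fun t => ?_⟩
    simp [Polynomial.aeval_fn_apply, mul_comm t]
  obtain ⟨P, hP⟩ := hline
  exact ⟨P, fun t => by simpa [Polynomial.aeval_fn_apply] using (congrFun hP t).symm⟩

instance noZeroDivisors_polyFun : NoZeroDivisors (polyFun W) where
  eq_zero_or_eq_zero_of_mul_eq_zero {p q} hpq := by
    -- Both restrict to nonzero polynomials on the line through points where they do not vanish.
    by_contra! hne
    obtain ⟨a, ha⟩ := Function.ne_iff.mp (Subtype.coe_ne_coe.mpr hne.1)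
    obtain ⟨b, hb⟩ := Function.ne_iff.mp (Subtype.coe_ne_coe.mpr hne.2)
    obtain ⟨P, hP⟩ := exists_polynomial_of_mem_polyFun p.2 a (b - a)
    obtain ⟨Q, hQ⟩ := exists_polynomial_of_mem_polyFun q.2 a (b - a)
    have hPQ : P * Q = 0 := Polynomial.funext fun t => by
      simpa [hP, hQ] using congrFun (congrArg Subtype.val hpq) (a + t • (b - a))
    rcases mul_eq_zero.mp hPQ with h0 | h0
    · exact ha (by simpa [h0] using hP 0)
    · exact hb (by simpa [h0] using hQ 1)

end PolynomialFunctions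

section Invariants

variable {G W W' : Type*} [Group G] [AddCommGroup W] [Module ℂ W] [AddCommGroup W'] [Module ℂ W']
  {ρ : Representation ℂ G W} {ρ' : Representation ℂ G W'}

instance noZeroDivisors_invariantAlgebra : NoZeroDivisors (invariantAlgebra ρ) :=
  have hle : invariantAlgebra ρ ≤ polyFun W := fun _ hp => hp.1
  (Subalgebra.inclusion_injective hle).noZeroDivisors _ (map_zero _) (map_mul _)

/-- Pullback of invariant polynomial functions along an equivariant linear map. -/
def invariantAlgebraComap (f : ρ.IntertwiningMap ρ') :
    invariantAlgebra ρ' →ₐ[ℂ] invariantAlgebra ρ where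
  toFun p := ⟨p.1 ∘ f,
    comp_mem_of_mem_polyFun (fun φ => dual_mem_polyFun (φ ∘ₗ f.toLinearMap)) p.2.1,
    fun g w => by simp [f.isIntertwining, p.2.2]⟩
  map_zero' := rfl
  map_one' := rfl
  map_add' _ _ := rfl
  map_mul' _ _ := rfl
  commutes' _ := rfl

/-- Equivalent representations have isomorphic algebras of invariants; the isomorphism is
contravariant, being given by pullback. -/
def invariantAlgebraCongr (e : ρ.Equiv ρ') : invariantAlgebra ρ' ≃ₐ[ℂ] invariantAlgebra ρ :=
  .ofAlgHom (invariantAlgebraComap e.toIntertwiningMap)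
    (invariantAlgebraComap e.symm.toIntertwiningMap)
    (by ext p w; simp [invariantAlgebraComap])
    (by ext p w; simp [invariantAlgebraComap])

end Invariants

section AreaForm

open Matrix

variable {R K : Type*} [CommRing R] [Field K]

/-- The standard area form `[u, v]` on the plane, the bracket of classical invariant theory. -/
noncomputable def areaForm (R : Type*) [CommRing R] : LinearMap.BilinForm R (Fin 2 → R) :=
  Matrix.toBilin' !![0, 1; -1, 0]

theorem areaForm_apply (u v : Fin 2 → R) : areaForm R u v = u 0 * v 1 - u 1 * v 0 := by
  simp [areaForm, Matrix.toBilin'_apply, Fin.sum_univ_two, sub_eq_add_neg]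

theorem areaForm_self (u : Fin 2 → R) : areaForm R u u = 0 := by
  rw [areaForm_apply, mul_comm, sub_self]

theorem nondegenerate_areaForm : (areaForm K).Nondegenerate :=
  LinearMap.BilinForm.nondegenerate_toBilin'_of_det_ne_zero' _ (by simp)

theorem areaForm_mulVec_mulVec (M : Matrix (Fin 2) (Fin 2) R) (u v : Fin 2 → R) :
    areaForm R (M *ᵥ u) (M *ᵥ v) = M.det * areaForm R u v := by
  simp only [areaForm_apply, det_fin_two, mulVec, dotProduct, Fin.sum_univ_two]
  ring

theorem exists_mulVec_eq_of_areaForm_ne_zero {u v : Fin 2 → K} (huv : areaForm K u v ≠ 0) :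
    ∃ g : SpecialLinearGroup (Fin 2) K, ∀ z,
      (g : Matrix (Fin 2) (Fin 2) K) *ᵥ z = ![areaForm K z v / areaForm K u v, areaForm K u z] := by
  let M : Matrix (Fin 2) (Fin 2) K :=
    !![v 1 / areaForm K u v, -v 0 / areaForm K u v; -u 1, u 0]
  have hM : M.det = 1 := by
    rw [det_fin_two_of, ← div_self huv]
    simp only [areaForm_apply]
    ring
  refine ⟨⟨M, hM⟩, fun z => ?_⟩
  ext i
  fin_cases i <;> simp [M, mulVec, dotProduct, areaForm_apply] <;> ring

end AreaForm

section Vectors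

open Matrix MvPolynomial

/-- The diagonal action of `SL₂` on `n`-tuples of vectors of `ℂ²`. -/
def vectorsRep (n : ℕ) : Representation ℂ SL2 (Fin n → Fin 2 → ℂ) where
  toFun g := (stdRep g).compLeft (Fin n)
  map_one' := by ext; simp
  map_mul' g h := by ext; simp

theorem areaForm_stdRep (g : SL2) (u v : Fin 2 → ℂ) :
    areaForm ℂ (stdRep g u) (stdRep g v) = areaForm ℂ u v := by
  change areaForm ℂ (g.1 *ᵥ u) (g.1 *ᵥ v) = _
  rw [areaForm_mulVec_mulVec, g.2, one_mul]

/-- The bracket `[vᵢ, vⱼ]` as an invariant of `n` vectors `v₀, …, vₙ₋₁`. -/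
noncomputable def bracketInvariant {n : ℕ} (i j : Fin n) : invariantAlgebra (vectorsRep n) :=
  ⟨fun v => areaForm ℂ (v i) (v j), by
    have hcoord (i : Fin n) (a : Fin 2) : (fun v => v i a) ∈ polyFun (Fin n → Fin 2 → ℂ) :=
      dual_mem_polyFun (W := Fin n → Fin 2 → ℂ) (LinearMap.proj a ∘ₗ LinearMap.proj i)
    simp only [areaForm_apply]
    exact sub_mem (mul_mem (hcoord i 0) (hcoord j 1)) (mul_mem (hcoord i 1) (hcoord j 0)),
    fun g v => areaForm_stdRep g (v i) (v j)⟩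

variable {k : ℕ}

/-- Index set of the frame brackets: `none` stands for `[v₀, v₁]`, and `some (inl j)` and
`some (inr j)` for the brackets of the `j`-th remaining vector with `v₀` and `v₁`. -/
abbrev FrameIndex (k : ℕ) : Type := Option (Fin k ⊕ Fin k)

/-- The brackets `[v₀, v₁]`, `[v₀, vⱼ]` and `[vⱼ, v₁]` of a tuple of vectors: by Cramer's rule the
last two are `[v₀, v₁]` times the coordinates of `vⱼ` in the frame `v₀, v₁`. -/
noncomputable def frameBracket : FrameIndex k → invariantAlgebra (vectorsRep (k + 2))
  | none => bracketInvariant 0 1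
  | some (.inl j) => bracketInvariant 0 j.succ.succ
  | some (.inr j) => bracketInvariant j.succ.succ 1

/-- The normal form `(1, 0), (0, t), (xⱼ / t, yⱼ)` of the tuples whose frame brackets are the
entries of `c`. It has these brackets only if `t = c none` is nonzero; otherwise `xⱼ / t` is `0`. -/
noncomputable def frameSection (c : FrameIndex k → ℂ) : Fin (k + 2) → Fin 2 → ℂ :=
  Fin.cons ![1, 0] (Fin.cons ![0, c none]
    fun j => ![c (some (.inr j)) / c none, c (some (.inl j))])

theorem frameBracket_frameSection {c : FrameIndex k → ℂ} (hc : c none ≠ 0) (i : FrameIndex k) :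
    (frameBracket i).1 (frameSection c) = c i := by
  have h0 : frameSection c 0 = ![1, 0] := rfl
  have h1 : frameSection c 1 = ![0, c none] := rfl
  have h2 (j : Fin k) : frameSection c j.succ.succ =
      ![c (some (.inr j)) / c none, c (some (.inl j))] := rfl
  rcases i with _ | j | j <;> simp [frameBracket, bracketInvariant, areaForm_apply, h0, h1, h2, hc]

theorem exists_vectorsRep_eq_frameSection {v : Fin (k + 2) → Fin 2 → ℂ}
    (hv : (frameBracket none).1 v ≠ 0) :
    ∃ g : SL2, vectorsRep (k + 2) g v = frameSection fun i => (frameBracket i).1 v := by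
  obtain ⟨g, hg⟩ := exists_mulVec_eq_of_areaForm_ne_zero hv
  refine ⟨g, funext fun j => (hg (v j)).trans ?_⟩
  have hv' : areaForm ℂ (v 0) (v 1) ≠ 0 := hv
  refine Fin.cases ?_ (Fin.cases ?_ fun j => rfl) j
  · change ![_, _] = ![1, 0]
    simp [hv', areaForm_self]
  · change ![_, _] = ![0, areaForm ℂ (v 0) (v 1)]
    simp [areaForm_self]

theorem frameSection_apply_mem_regularAway (j : Fin (k + 2)) (a : Fin 2) :
    (fun c => frameSection c j a) ∈ regularAway (X (R := ℂ) (none : FrameIndex k)) := by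
  have hX (i : FrameIndex k) : (fun c => c i) ∈ regularAway (X (R := ℂ) none) := by
    simpa using eval_mem_regularAway (X none) (X (R := ℂ) i)
  have hinv : (fun c => (c none)⁻¹) ∈ regularAway (X (R := ℂ) (none : FrameIndex k)) := by
    simpa using inv_eval_mem_regularAway (X (R := ℂ) (none : FrameIndex k))
  refine Fin.cases ?_ (Fin.cases ?_ fun j => ?_) j <;> fin_cases a
  · exact one_mem _
  · exact zero_mem _
  · exact zero_mem _
  · exact hX none
  · exact mul_mem (hX (some (.inr j))) hinv
  · exact hX (some (.inl j))

theorem comp_frameSection_mem_regularAway {p : (Fin (k + 2) → Fin 2 → ℂ) → ℂ}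
    (hp : p ∈ polyFun (Fin (k + 2) → Fin 2 → ℂ)) :
    p ∘ frameSection ∈ regularAway (X (R := ℂ) (none : FrameIndex k)) := by
  let b := Pi.basis fun _ : Fin (k + 2) => Pi.basisFun ℂ (Fin 2)
  refine comp_mem_of_mem_polyFun_of_basis b (fun ⟨j, a⟩ => ?_) hp
  convert frameSection_apply_mem_regularAway j a using 1
  ext c
  simp [b]

theorem isTranscendenceBasis_frameBracket :
    IsTranscendenceBasis ℂ (frameBracket (k := k)) := by
  refine isTranscendenceBasis_of_section (d := X none) (s := frameSection) (X_ne_zero _)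
    (fun c hc => frameBracket_frameSection (by simpa using hc))
    (fun p hp => comp_frameSection_mem_regularAway hp.1) fun p hp v hv => ?_
  obtain ⟨g, hg⟩ := exists_vectorsRep_eq_frameSection (v := v) (by simpa using hv)
  rw [← hg, hp.2]

theorem trdeg_invariantAlgebra_vectorsRep (k : ℕ) :
    Algebra.trdeg ℂ (invariantAlgebra (vectorsRep (k + 2))) = ((2 * k + 1 : ℕ) : Cardinal) := by
  rw [← isTranscendenceBasis_frameBracket.cardinalMk_eq_trdeg, Cardinal.mk_fintype]
  simp [two_mul]

end Vectors

section Forms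

/-- The `SL₂`-equivariant identification of vectors with linear binary forms, `v ↦ [v, ·]`. -/
noncomputable def vectorEquivForm : stdRep.Equiv formRep :=
  .mk ((areaForm ℂ).toDual nondegenerate_areaForm) fun g => by
    refine LinearMap.ext fun u => LinearMap.ext fun z => ?_
    change areaForm ℂ (stdRep g u) z = areaForm ℂ u (stdRep g⁻¹ z)
    rw [← areaForm_stdRep g u, Representation.self_inv_apply]

/-- The identification of `n`-tuples of vectors with `n`-tuples of linear binary forms. -/
noncomputable def vectorsEquivForms (n : ℕ) : (vectorsRep n).Equiv (formsRep n) :=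
  .mk (.piCongrRight fun _ => vectorEquivForm.toLinearEquiv) fun g =>
    LinearMap.ext fun v => funext fun i => vectorEquivForm.isIntertwining _ _ g (v i)

/-- The identification of `n + 1` vectors with `n` linear binary forms, which come from the last
`n` vectors, and one vector. -/
noncomputable def vectorsSuccEquivFormsProd (n : ℕ) :
    (vectorsRep (n + 1)).Equiv ((formsRep n).prod stdRep) :=
  .mk ((Fin.consLinearEquiv ℂ fun _ : Fin (n + 1) => Fin 2 → ℂ).symm ≪≫ₗ
      LinearEquiv.prodComm ℂ _ _ ≪≫ₗ
      .prodCongr (vectorsEquivForms n).toLinearEquiv (.refl ℂ _)) fun g =>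
    LinearMap.ext fun v => Prod.ext ((vectorsEquivForms n).isIntertwining _ _ g (Fin.tail v)) rfl

end Forms

theorem theorem2 (n : ℕ) :
    (2 ≤ n → Algebra.trdeg ℂ (jointInvariants n) = ((2 * n - 3 : ℕ) : Cardinal)) ∧
    (1 ≤ n → Algebra.trdeg ℂ (jointCovariants n) = ((2 * n - 1 : ℕ) : Cardinal)) := by
  refine ⟨fun hn => ?_, fun hn => ?_⟩
  · obtain ⟨k, rfl⟩ := Nat.exists_eq_add_of_le' hn
    rw [jointInvariants, (invariantAlgebraCongr (vectorsEquivForms (k + 2))).trdeg_eq,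
      trdeg_invariantAlgebra_vectorsRep, show 2 * (k + 2) - 3 = 2 * k + 1 by lia]
  · obtain ⟨k, rfl⟩ := Nat.exists_eq_add_of_le' hn
    rw [jointCovariants, (invariantAlgebraCongr (vectorsSuccEquivFormsProd (k + 1))).trdeg_eq,
      trdeg_invariantAlgebra_vectorsRep, show 2 * (k + 1) - 1 = 2 * k + 1 by lia]
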